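/- Let $\mathbb{N}=\{1,2,3,\dots\}$, let $M$ be a commutative monoid (written additively), and let $\mu\colon M\times M\to M$ be a biadditive binary operation, i.e. $\mu(a+a',b)=\mu(a,b)+\mu(a',b)$ and $\mu(a,b+b')=\mu(a,b)+\mu(a,b')$ for all $a,a',b,b'\in M$ (it is not required that $\mu(0,b)=0$ or $\mu(a,0)=0$). For $a,b\in M$ write $a\lesssim b$ if there are $c,t\in M$ and $k\in\mathbb{N}$ with $ka+c+t=kb+t$. An element $s\in M$ is called $\mu$-localizable if, for all $a,b\in M$, each of the conditions $\mu(s,a)+a\lesssim\mu(s,b)+b$ and $\mu(a,s)+a\lesssim\mu(b,s)+b$ implies $a\lesssim b$. The monoid $M$ is called weakly $\mu$-localizable if for every $a\in M$ there is a $\mu$-localizable $s\in M$ with $a\lesssim s$. Let $\mathrm{Gr}(M)$ be the Grothendieck group of $M$ with canonical additive map $\iota\colon M\to\mathrm{Gr}(M)$. For a submonoid $S$ of an abelian group $G$ put $S^{\mathrm{up}}=\{a\in G : ka\in S\text{ for some }k\in\mathbb{N}\}$ and $S^{\ddagger}=\{a\in G : \text{there is } e\in G \text{ with } \ell a+e\in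 S\text{ for all }\ell\in\mathbb{N}\}$, and let $S^{\mathrm{up}\ddagger}=(S^{\mathrm{up}})^{\ddagger}$. The second reduced Grothendieck group of $M$ is the quotient group $$\nabla_2(M)=\mathrm{Gr}(M)\big/\bigl(\iota(M)^{\mathrm{up}\ddagger}\cap(-\iota(M)^{\mathrm{up}\ddagger})\bigr).$$ Let $\iota_2\colon M\to\nabla_2(M)$ be the composition of $\iota$ with the quotient map, and let $\mu_{\nabla,2}$ be the biadditive binary operation on $\nabla_2(M)$ induced by $\mu$, i.e. the unique biadditive binary operation on $\nabla_2(M)$ with $\mu_{\nabla,2}(\iota_2(a),\iota_2(b))=\iota_2(\mu(a,b))$ for all $a,b\in M$. If $M$ is weakly $\mu$-localizable, then $\mu_{\nabla,2}$ is associative and commutative. Thus the abelian group $\nabla_2(M)$ with multiplication $\mu_{\nabla,2}$ is a commutative (possibly non-unital) ring. -/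

import Mathlib

/-! ## The canonical quasi-order and localizability -/

/-- The canonical quasi-order of a commutative monoid:
`a ≲ b` if `k a + c + t = k b + t` for some `c, t ∈ M` and some integer `k ≥ 1`. -/
def CanLE {M : Type*} [AddCommMonoid M] (a b : M) : Prop :=
  ∃ (c t : M) (k : ℕ), 0 < k ∧ k • a + c + t = k • b + t

/-- A binary operation is biadditive if it preserves addition in each argument separately.
(It is not required to preserve `0`.) -/
structure IsBiadditive {M : Type*} [AddCommMonoid M] (μ : M → M → M) : Prop where
  add_left : ∀ a b c : M, μ (a + b) c = μ a c + μ b c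
  add_right : ∀ a b c : M, μ a (b + c) = μ a b + μ a c

/-- `s` is left `μ`-localizable. -/
def IsLeftLocalizable {M : Type*} [AddCommMonoid M] (μ : M → M → M) (s : M) : Prop :=
  ∀ a b : M, CanLE (μ s a + a) (μ s b + b) → CanLE a b

/-- `s` is `μ`-localizable: left localizable for `μ` and for the opposite operation of `μ`. -/
def IsLocalizable {M : Type*} [AddCommMonoid M] (μ : M → M → M) (s : M) : Prop :=
  IsLeftLocalizable μ s ∧ IsLeftLocalizable (fun a b => μ b a) s

/-- `M` is weakly `μ`-localizable. -/
def IsWeaklyLocalizable {M : Type*} [AddCommMonoid M] (μ : M → M → M) : Prop :=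
  ∀ a : M, ∃ s : M, IsLocalizable μ s ∧ CanLE a s

/-! ## The second reduced Grothendieck group -/

/-- `S^up`: all `a` with `k a ∈ S` for some integer `k ≥ 1`. -/
def AddSubmonoid.up {G : Type*} [AddCommGroup G] (S : AddSubmonoid G) : AddSubmonoid G where
  carrier := {a | ∃ k : ℕ, 0 < k ∧ k • a ∈ S}
  zero_mem' := ⟨1, one_pos, by simp⟩
  add_mem' := by
    rintro a b ⟨k, hk, ha⟩ ⟨l, hl, hb⟩
    refine ⟨k * l, Nat.mul_pos hk hl, ?_⟩
    rw [nsmul_add, mul_nsmul, mul_nsmul' b k l]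
    exact S.add_mem (S.nsmul_mem ha l) (S.nsmul_mem hb k)

/-- `S^‡`: all `a` for which there is `e ∈ G` with `ℓ a + e ∈ S` for all integers `ℓ ≥ 1`. -/
def AddSubmonoid.ddagger {G : Type*} [AddCommGroup G] (S : AddSubmonoid G) : AddSubmonoid G where
  carrier := {a | ∃ e : G, ∀ l : ℕ, 0 < l → l • a + e ∈ S}
  zero_mem' := ⟨0, fun l _ => by simp⟩
  add_mem' := by
    rintro a b ⟨e, he⟩ ⟨f, hf⟩
    refine ⟨e + f, fun l hl => ?_⟩
    rw [nsmul_add, add_add_add_comm]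
    exact S.add_mem (he l hl) (hf l hl)

/-- The image `ι(M)` of `M` in its Grothendieck group. -/
abbrev grothImage (M : Type*) [AddCommMonoid M] :
    AddSubmonoid (Algebra.GrothendieckAddGroup M) :=
  AddMonoidHom.mrange (Algebra.GrothendieckAddGroup.of (M := M))

/-- The subgroup `ι(M)^{up‡} ∩ (-ι(M)^{up‡})` of the Grothendieck group of `M`. -/
def redSndKer (M : Type*) [AddCommMonoid M] : AddSubgroup (Algebra.GrothendieckAddGroup M) :=
  (grothImage M).up.ddagger.support

/-- The second reduced Grothendieck group of `M`. -/
abbrev RedGrothSnd (M : Type*) [AddCommMonoid M] : Type _ :=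
  Algebra.GrothendieckAddGroup M ⧸ redSndKer M

/-- The canonical additive map from `M` to its second reduced Grothendieck group. -/
noncomputable def redSndOf (M : Type*) [AddCommMonoid M] : M →+ RedGrothSnd M :=
  (QuotientAddGroup.mk' (redSndKer M)).comp (Algebra.GrothendieckAddGroup.of (M := M))

/-! ## The induced operation -/

/-- An additive map from a commutative monoid to an abelian group automatically maps `0` to `0`. -/
def homOfAdditive {M G : Type*} [AddCommMonoid M] [AddCommGroup G] (f : M → G)
    (hf : ∀ a b, f (a + b) = f a + f b) : M →+ G where
  toFun := f
  map_zero' := by simpa using hf 0 0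
  map_add' := hf

theorem groth_lift_of {M G : Type*} [AddCommMonoid M] [AddCommGroup G] (f : M →+ G) (a : M) :
    Algebra.GrothendieckAddGroup.lift f (Algebra.GrothendieckAddGroup.of a) = f a :=
  DFunLike.congr_fun (Algebra.GrothendieckAddGroup.lift.symm_apply_apply f) a

theorem groth_hom_ext {M G : Type*} [AddCommMonoid M] [AddCommGroup G]
    {f g : Algebra.GrothendieckAddGroup M →+ G}
    (h : ∀ a : M, f (Algebra.GrothendieckAddGroup.of a) =
      g (Algebra.GrothendieckAddGroup.of a)) : f = g :=
  Algebra.GrothendieckAddGroup.lift.symm.injective (AddMonoidHom.ext h)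

/-- For fixed `a`, the extension of `μ(a, ·)` to the Grothendieck group. -/
noncomputable def grothMulLeft {M : Type*} [AddCommMonoid M] (μ : M → M → M)
    (hμ : IsBiadditive μ) (a : M) :
    Algebra.GrothendieckAddGroup M →+ Algebra.GrothendieckAddGroup M :=
  Algebra.GrothendieckAddGroup.lift <|
    homOfAdditive (fun b => Algebra.GrothendieckAddGroup.of (μ a b))
      (fun b c => by rw [hμ.add_right, map_add])

theorem grothMulLeft_of {M : Type*} [AddCommMonoid M] (μ : M → M → M) (hμ : IsBiadditive μ)
    (a b : M) :
    grothMulLeft μ hμ a (Algebra.GrothendieckAddGroup.of b) =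
      Algebra.GrothendieckAddGroup.of (μ a b) :=
  groth_lift_of _ _

/-- The biadditive operation induced by `μ` on the Grothendieck group; it satisfies
`ι(a) * ι(b) = ι(μ(a, b))`. -/
noncomputable def grothMul {M : Type*} [AddCommMonoid M] (μ : M → M → M) (hμ : IsBiadditive μ) :
    Algebra.GrothendieckAddGroup M →+
      Algebra.GrothendieckAddGroup M →+ Algebra.GrothendieckAddGroup M :=
  Algebra.GrothendieckAddGroup.lift <| homOfAdditive (grothMulLeft μ hμ) fun a b =>
    groth_hom_ext fun c => by
      rw [AddMonoidHom.add_apply, grothMulLeft_of, grothMulLeft_of, grothMulLeft_of,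
        hμ.add_left, map_add]

theorem grothMul_of {M : Type*} [AddCommMonoid M] (μ : M → M → M) (hμ : IsBiadditive μ) (a b : M) :
    grothMul μ hμ (Algebra.GrothendieckAddGroup.of a) (Algebra.GrothendieckAddGroup.of b) =
      Algebra.GrothendieckAddGroup.of (μ a b) :=
  (DFunLike.congr_fun (groth_lift_of _ a) _).trans (grothMulLeft_of μ hμ a b)

/-- Every element of the Grothendieck group is a difference of elements of the image of `M`. -/
theorem groth_exists_sub {M : Type*} [AddCommMonoid M] (x : Algebra.GrothendieckAddGroup M) :
    ∃ a b : M, x = Algebra.GrothendieckAddGroup.of a - Algebra.GrothendieckAddGroup.of b := by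
  obtain ⟨⟨a, b⟩, h⟩ := (AddLocalization.addMonoidOf (⊤ : AddSubmonoid M)).surj x
  exact ⟨a, b, eq_sub_of_add_eq h⟩

/-- An endomorphism of the Grothendieck group that preserves `ι(M)` preserves
`ι(M)^{up‡} ∩ (-ι(M)^{up‡})`. -/
theorem map_mem_redSndKer {M : Type*} [AddCommMonoid M]
    (f : Algebra.GrothendieckAddGroup M →+ Algebra.GrothendieckAddGroup M)
    (hf : ∀ x ∈ grothImage M, f x ∈ grothImage M) {x : Algebra.GrothendieckAddGroup M}
    (hx : x ∈ redSndKer M) : f x ∈ redSndKer M := by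
  have key : ∀ y ∈ (grothImage M).up.ddagger, f y ∈ (grothImage M).up.ddagger := by
    rintro y ⟨e, he⟩
    refine ⟨f e, fun l hl => ?_⟩
    obtain ⟨k, hk, h⟩ := he l hl
    refine ⟨k, hk, ?_⟩
    have h' := hf _ h
    rwa [map_nsmul, map_add, map_nsmul] at h'
  refine ⟨key x hx.1, ?_⟩
  have h' := key (-x) hx.2
  rwa [map_neg] at h'

theorem grothMul_mem_right {M : Type*} [AddCommMonoid M] (μ : M → M → M) (hμ : IsBiadditive μ)
    (x : Algebra.GrothendieckAddGroup M) {y : Algebra.GrothendieckAddGroup M}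
    (hy : y ∈ redSndKer M) : grothMul μ hμ x y ∈ redSndKer M := by
  obtain ⟨a, b, rfl⟩ := groth_exists_sub x
  have key : ∀ c : M,
      grothMul μ hμ (Algebra.GrothendieckAddGroup.of c) y ∈ redSndKer M := fun c =>
    map_mem_redSndKer _ (by
      rintro _ ⟨d, rfl⟩
      exact ⟨μ c d, (grothMul_of μ hμ c d).symm⟩) hy
  rw [map_sub, AddMonoidHom.sub_apply]
  exact sub_mem (key a) (key b)

theorem grothMul_mem_left {M : Type*} [AddCommMonoid M] (μ : M → M → M) (hμ : IsBiadditive μ)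
    {x : Algebra.GrothendieckAddGroup M} (hx : x ∈ redSndKer M)
    (y : Algebra.GrothendieckAddGroup M) : grothMul μ hμ x y ∈ redSndKer M := by
  obtain ⟨a, b, rfl⟩ := groth_exists_sub y
  have key : ∀ c : M,
      grothMul μ hμ x (Algebra.GrothendieckAddGroup.of c) ∈ redSndKer M := fun c =>
    map_mem_redSndKer ((grothMul μ hμ).flip (Algebra.GrothendieckAddGroup.of c)) (by
      rintro _ ⟨d, rfl⟩
      exact ⟨μ d c, (grothMul_of μ hμ d c).symm⟩) hx
  rw [map_sub]
  exact sub_mem (key a) (key b)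

/-- The biadditive operation `μ_{∇,2}` induced by `μ` on the second reduced Grothendieck group:
`[x] * [y] = [x * y]` for the induced operation on the Grothendieck group. -/
noncomputable def redSndMul {M : Type*} [AddCommMonoid M] (μ : M → M → M) (hμ : IsBiadditive μ) :
    RedGrothSnd M → RedGrothSnd M → RedGrothSnd M :=
  Quotient.map₂ (fun x y => grothMul μ hμ x y) fun x x' hx y y' hy => by
    have hx' : -x + x' ∈ redSndKer M := QuotientAddGroup.leftRel_apply.mp hx
    have hy' : -y + y' ∈ redSndKer M := QuotientAddGroup.leftRel_apply.mp hy
    refine QuotientAddGroup.leftRel_apply.mpr ?_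
    have h := add_mem (grothMul_mem_left μ hμ hx' y) (grothMul_mem_right μ hμ x' hy')
    simp only [map_add, map_neg, AddMonoidHom.add_apply, AddMonoidHom.neg_apply] at h
    convert h using 1
    abel

/-- `μ_{∇,2}` is the unique biadditive operation with
`μ_{∇,2}(ι₂(a), ι₂(b)) = ι₂(μ(a, b))` for all `a, b ∈ M`. -/
theorem redSndMul_unique {M : Type*} [AddCommMonoid M] (μ : M → M → M) (hμ : IsBiadditive μ)
    (ν : RedGrothSnd M → RedGrothSnd M → RedGrothSnd M) :
    (IsBiadditive ν ∧ ∀ a b : M, ν (redSndOf M a) (redSndOf M b) = redSndOf M (μ a b)) ↔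
      ν = redSndMul μ hμ := by
  constructor
  · rintro ⟨hν, h⟩
    have neg_left : ∀ x y, ν (-x) y = -ν x y := fun x y =>
      map_neg (homOfAdditive (fun x => ν x y) (fun a b => hν.add_left a b y)) x
    have neg_right : ∀ x y, ν x (-y) = -ν x y := fun x y =>
      map_neg (homOfAdditive (ν x) (hν.add_right x)) y
    funext x y
    induction x using QuotientAddGroup.induction_on with | H x => ?_
    induction y using QuotientAddGroup.induction_on with | H y => ?_
    obtain ⟨a, b, rfl⟩ := groth_exists_sub x
    obtain ⟨c, d, rfl⟩ := groth_exists_sub y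
    have e : ∀ a b : M, ((Algebra.GrothendieckAddGroup.of a - Algebra.GrothendieckAddGroup.of b :
        Algebra.GrothendieckAddGroup M) : RedGrothSnd M) = redSndOf M a + -redSndOf M b :=
      fun a b => by rw [← sub_eq_add_neg]; rfl
    have e' : redSndMul μ hμ
        ((Algebra.GrothendieckAddGroup.of a - Algebra.GrothendieckAddGroup.of b :
          Algebra.GrothendieckAddGroup M) : RedGrothSnd M)
        ((Algebra.GrothendieckAddGroup.of c - Algebra.GrothendieckAddGroup.of d :
          Algebra.GrothendieckAddGroup M) : RedGrothSnd M) =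
        redSndOf M (μ a c) - redSndOf M (μ b c) - (redSndOf M (μ a d) - redSndOf M (μ b d)) := by
      change ((grothMul μ hμ _ _ : Algebra.GrothendieckAddGroup M) : RedGrothSnd M) = _
      rw [map_sub, map_sub, AddMonoidHom.sub_apply, AddMonoidHom.sub_apply,
        grothMul_of, grothMul_of, grothMul_of, grothMul_of]
      rfl
    rw [e', e, e, hν.add_left, hν.add_right, hν.add_right, neg_left, neg_left, neg_right,
      neg_right, h, h, h, h]
    abel
  · rintro rfl
    refine ⟨⟨?_, ?_⟩, ?_⟩
    · rintro ⟨x⟩ ⟨y⟩ ⟨z⟩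
      exact congrArg (QuotientAddGroup.mk' (redSndKer M))
        (DFunLike.congr_fun (map_add (grothMul μ hμ) x y) z)
    · rintro ⟨x⟩ ⟨y⟩ ⟨z⟩
      exact congrArg (QuotientAddGroup.mk' (redSndKer M)) (map_add (grothMul μ hμ x) y z)
    · intro a b
      exact congrArg (QuotientAddGroup.mk' (redSndKer M)) (grothMul_of μ hμ a b)

/-!
Preorder `Gr(M)` by the positive cone `ι(M)^up` and write the induced operation as a product. Let
`s` be localizable and let `f` be an extreme state of the order ideal `I` generated by a positive
element. Since `H x = x + s x` reflects positivity, the Mazur–Orlicz theorem gives a positive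
functional `g` on a larger ideal with `g ∘ H = f`. If `0 ≤ S ≤ H` on positive elements, then
`0 ≤ g ∘ S ≤ f` there, and extremality of `f` makes `g ∘ S` a multiple of `f`. This applies to the
inclusion of `I` and to multiplication by any `a` between `0` and `s`. Hence either `g` vanishes on
`I`, and then `f x = g (x + s x) = 0` whenever `s x ∈ I`, or there are scalars with
`f (a x) = λ(a) f x`; in the same way `f (x a) = ρ(a) f x`.

Therefore `f ((a b) c) = λ(a) ρ(c) f b = f (a (b c))`. Moreover `λ(a) f a = f (a a) = ρ(a) f a`, so
either `λ(a) = ρ(a)` or `f a = 0`, and in both cases `f (a b) = f (b a)`. By the Krein–Milman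
theorem associators and commutators are killed by all states, so that all their integer multiples
are bounded by the generator of the ideal. This is what it means to vanish in `∇₂(M)`.
-/

section Subadditive

variable {A : Type*} [AddCommGroup A] {p q : A → ℝ}

/-- Subadditivity of a real-valued function on an abelian group. Unlike a sublinear function, a
subadditive one need not be homogeneous. -/
def IsSubadditive (p : A → ℝ) : Prop :=
  ∀ x y, p (x + y) ≤ p x + p y

theorem isSubadditive_iInf {ι : Type*} [Nonempty ι] {r : ι → A → ℝ}
    (hbdd : ∀ x, BddBelow (Set.range fun i => r i x))
    (hr : ∀ x y i j, ∃ k, r k (x + y) ≤ r i x + r j y) :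
    IsSubadditive fun x => ⨅ i, r i x := fun x y =>
  le_ciInf_add_ciInf fun i j =>
    let ⟨k, hk⟩ := hr x y i j
    ciInf_le_of_le (hbdd _) k hk

namespace IsSubadditive

theorem neg_map_neg_le (hp : IsSubadditive p) (x : A) : -p (-x) ≤ p x := by
  have h₀ := hp 0 0
  have hx := hp x (-x)
  rw [add_zero] at h₀
  rw [add_neg_cancel] at hx
  linarith

theorem exists_le_of_isChain {c : Set (A → ℝ)} (hc : ∀ q ∈ c, IsSubadditive q)
    (hchain : IsChain (· ≤ ·) c) (hne : c.Nonempty) :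
    ∃ r, IsSubadditive r ∧ ∀ q ∈ c, r ≤ q := by
  obtain ⟨q₀, hq₀⟩ := hne
  have : Nonempty c := ⟨⟨q₀, hq₀⟩⟩
  have hbdd (x : A) : BddBelow (Set.range fun q : c => q.1 x) := by
    refine ⟨-q₀ (-x), Set.forall_mem_range.2 fun q => ?_⟩
    rcases hchain.total q.2 hq₀ with h | h
    · exact (neg_le_neg (h (-x))).trans ((hc q q.2).neg_map_neg_le x)
    · exact ((hc q₀ hq₀).neg_map_neg_le x).trans (h x)
  refine ⟨fun x => ⨅ q : c, q.1 x, isSubadditive_iInf hbdd fun x y q r => ?_,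
    fun q hq x => ciInf_le (hbdd x) ⟨q, hq⟩⟩
  rcases hchain.total q.2 r.2 with h | h
  · exact ⟨q, (hc q q.2 x y).trans (by gcongr; exact h y)⟩
  · exact ⟨r, (hc r r.2 x y).trans (by gcongr; exact h x)⟩

theorem exists_minimal_le (hp : IsSubadditive p) : ∃ q ≤ p, Minimal IsSubadditive q :=
  zorn_le_nonempty₀ (α := (A → ℝ)ᵒᵈ) {q | IsSubadditive (A := A) q}
    (fun _ hc hchain r hr => exists_le_of_isChain hc hchain.symm ⟨r, hr⟩) p hp

theorem map_nsmul_le (hp : IsSubadditive p) {k : ℕ} (hk : k ≠ 0) (x : A) :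
    p (k • x) ≤ k * p x := by
  induction k, Nat.one_le_iff_ne_zero.2 hk using Nat.le_induction with
  | base => simp
  | succ n hn ih =>
    have := ih (Nat.one_le_iff_ne_zero.1 hn)
    rw [succ_nsmul]
    push_cast
    linarith [hp (n • x) x]

theorem map_nsmul_of_minimal (hq : Minimal IsSubadditive q) (k : ℕ) (x : A) :
    q (k • x) = k * q x := by
  have map_nsmul {k : ℕ} (hk : k ≠ 0) (x : A) : q (k • x) = k * q x := by
    have hk' : (0 : ℝ) < k := by positivity
    have hsub : IsSubadditive fun x => q (k • x) / k := fun x y => by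
      dsimp only
      rw [nsmul_add, ← add_div]
      gcongr
      exact hq.prop _ _
    have hle : (fun x => q (k • x) / k) ≤ q := fun x =>
      (div_le_iff₀' hk').2 (hq.prop.map_nsmul_le hk x)
    exact (hq.prop.map_nsmul_le hk x).antisymm ((le_div_iff₀' hk').1 (hq.le_of_le hsub hle x))
  rcases eq_or_ne k 0 with rfl | hk
  · have := map_nsmul two_ne_zero 0
    rw [nsmul_zero] at this
    push_cast at this
    rw [zero_nsmul, Nat.cast_zero, zero_mul]
    linarith
  · exact map_nsmul hk x

theorem map_neg_le_of_minimal (hq : Minimal IsSubadditive q) (y : A) : q (-y) ≤ -q y := by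
  -- `q` is lowered along `y`: the infimum of `q (x + n • y) - n * q y` over `n` is subadditive in
  -- `x`, is at most `q`, and is at most `-q y` at `x = -y`.
  have hbdd (x : A) : BddBelow (Set.range fun n : ℕ => q (x + n • y) - n * q y) := by
    refine ⟨-q (-x), Set.forall_mem_range.2 fun n => ?_⟩
    have := hq.prop (x + n • y) (-x)
    rw [add_neg_cancel_comm, map_nsmul_of_minimal hq] at this
    linarith
  have hsub : IsSubadditive fun x => ⨅ n : ℕ, (q (x + n • y) - n * q y) :=
    isSubadditive_iInf hbdd fun x z m n => ⟨m + n, by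
      have := hq.prop (x + m • y) (z + n • y)
      rw [add_add_add_comm, ← add_nsmul] at this
      push_cast
      linarith⟩
  have hle := hq.le_of_le hsub fun x => ciInf_le_of_le (hbdd x) 0 (by simp)
  refine (hle (-y)).trans (ciInf_le_of_le (hbdd _) 1 ?_)
  have map_zero : q 0 = 0 := by simpa using map_nsmul_of_minimal hq 0 0
  simp [map_zero]

/-- A minimal subadditive function is additive; this is the Hahn–Banach theorem for groups. -/
theorem exists_addMonoidHom_le (hp : IsSubadditive p) : ∃ f : A →+ ℝ, ∀ x, f x ≤ p x := by
  obtain ⟨q, hqp, hq⟩ := hp.exists_minimal_le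
  refine ⟨AddMonoidHom.mk' q fun x y => (hq.prop x y).antisymm ?_, hqp⟩
  have := hq.prop (x + y) (-y)
  rw [add_neg_cancel_right] at this
  linarith [map_neg_le_of_minimal hq y]

end IsSubadditive

end Subadditive

section PositiveFunctionals

variable {A B : Type*} [AddCommGroup A] [Preorder A] [IsOrderedAddMonoid A]

theorem monotone_of_map_nonneg [AddCommGroup B] [Preorder B] [IsOrderedAddMonoid B] (f : A →+ B)
    (hf : ∀ x, 0 ≤ x → 0 ≤ f x) : Monotone f := fun x y h => by
  rw [← sub_nonneg, ← map_sub]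
  exact hf _ (sub_nonneg.2 h)

/-- The Mazur–Orlicz theorem for preordered groups. -/
theorem exists_orderAddMonoidHom_le [AddCommMonoid B] (h : B →+ A) (g : B →+ ℝ)
    (hg : ∀ b, 0 ≤ h b → 0 ≤ g b) (hcofinal : ∀ x, ∃ b, x ≤ h b) :
    ∃ f : A →+o ℝ, ∀ b, f (h b) ≤ g b := by
  have hne (x : A) : Nonempty {b // x ≤ h b} := nonempty_subtype.2 (hcofinal x)
  have hbdd (x : A) : BddBelow (Set.range fun b : {b // x ≤ h b} => g b) := by
    obtain ⟨c, hc⟩ := hcofinal (-x)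
    refine ⟨-g c, Set.forall_mem_range.2 fun ⟨b, hb⟩ => ?_⟩
    have := hg (b + c) (by simpa using add_le_add hb hc)
    rw [map_add] at this
    linarith
  have hsub : IsSubadditive fun x : A => ⨅ b : {b // x ≤ h b}, g b := fun x y =>
    le_ciInf_add_ciInf fun ⟨b, hb⟩ ⟨c, hc⟩ =>
      ciInf_le_of_le (hbdd _) ⟨b + c, (add_le_add hb hc).trans_eq (map_add h b c).symm⟩
        (map_add g b c).le
  obtain ⟨f, hf⟩ := hsub.exists_addMonoidHom_le
  have hle {x : A} {b : B} (hxb : x ≤ h b) : f x ≤ g b :=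
    (hf x).trans (ciInf_le (hbdd x) ⟨b, hxb⟩)
  refine ⟨⟨f, monotone_of_map_nonneg f fun x hx => ?_⟩, fun b => hle le_rfl⟩
  have := hle (x := -x) (b := 0) (by simpa using hx)
  rw [map_neg, map_zero] at this
  linarith

theorem exists_orderAddMonoidHom_eq [AddCommGroup B] (h : B →+ A) (g : B →+ ℝ)
    (hg : ∀ b, 0 ≤ h b → 0 ≤ g b) (hcofinal : ∀ x, ∃ b, x ≤ h b) :
    ∃ f : A →+o ℝ, ∀ b, f (h b) = g b := by
  obtain ⟨f, hf⟩ := exists_orderAddMonoidHom_le h g hg hcofinal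
  refine ⟨f, fun b => (hf b).antisymm ?_⟩
  have := hf (-b)
  rwa [map_neg, map_neg, map_neg, neg_le_neg_iff] at this

end PositiveFunctionals

section States

variable {A : Type*} [AddCommGroup A] [Preorder A] {e : A} {f : A → ℝ}

/-- The states of a preordered group with respect to `e`, as a subset of the product space
`A → ℝ`: the positive additive functionals with value `1` at `e`. -/
def stateSpace (e : A) : Set (A → ℝ) :=
  {f | (∀ x y, f (x + y) = f x + f y) ∧ Monotone f ∧ f e = 1}

/-- A positive element whose multiples dominate every element of the group. -/
structure IsOrderUnit (e : A) : Prop where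
  nonneg : 0 ≤ e
  exists_le_nsmul : ∀ x, ∃ n : ℕ, x ≤ n • e

theorem exists_orderAddMonoidHom_of_mem_stateSpace (hf : f ∈ stateSpace e) :
    ∃ F : A →+o ℝ, ⇑F = f :=
  ⟨⟨AddMonoidHom.mk' f hf.1, hf.2.1⟩, rfl⟩

theorem convex_stateSpace (e : A) : Convex ℝ (stateSpace e) := by
  rintro f ⟨hf, hf', hfe⟩ g ⟨hg, hg', hge⟩ a b ha hb hab
  refine ⟨fun x y => ?_, fun x y h => ?_, ?_⟩
  · simp only [Pi.add_apply, Pi.smul_apply, smul_eq_mul, hf x y, hg x y]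
    ring
  · simp only [Pi.add_apply, Pi.smul_apply, smul_eq_mul]
    gcongr
    exacts [hf' h, hg' h]
  · simpa [hfe, hge] using hab

theorem isCompact_stateSpace (he : IsOrderUnit e) : IsCompact (stateSpace e) := by
  choose n hn using he.exists_le_nsmul
  have hclosed : IsClosed (stateSpace e) :=
    (isClosed_setOfPred_map_add A ℝ).inter <|
      isClosed_monotone.inter (isClosed_eq (continuous_apply e) continuous_const)
  have hbox : IsCompact (Set.univ.pi fun x : A => Set.Icc (-n (-x) : ℝ) (n x)) :=
    isCompact_univ_pi fun _ => isCompact_Icc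
  refine hbox.of_isClosed_subset hclosed fun f hf x _ => ?_
  have hfe := hf.2.2
  obtain ⟨F, rfl⟩ := exists_orderAddMonoidHom_of_mem_stateSpace hf
  have hF (x : A) : F x ≤ n x := by simpa [hfe] using F.monotone' (hn x)
  exact ⟨neg_le.1 (map_neg F x ▸ hF (-x)), hF x⟩

theorem apply_eq_zero_of_forall_extremePoints (he : IsOrderUnit e) {y : A}
    (h : ∀ f ∈ (stateSpace e).extremePoints ℝ, f y = 0) (hf : f ∈ stateSpace e) : f y = 0 := by
  have hker_closed : IsClosed {g : A → ℝ | g y = 0} :=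
    isClosed_eq (continuous_apply y) continuous_const
  have hker_convex : Convex ℝ {g : A → ℝ | g y = 0} :=
    (LinearMap.ker (LinearMap.proj (R := ℝ) (φ := fun _ : A => ℝ) y)).convex
  rw [← closure_convexHull_extremePoints (isCompact_stateSpace he) (convex_stateSpace e)] at hf
  exact closure_minimal (convexHull_min h hker_convex) hker_closed hf

variable [IsOrderedAddMonoid A]

theorem addMonoidHom_mem_stateSpace (F : A →+ ℝ) (hF : ∀ x, 0 ≤ x → 0 ≤ F x) (hFe : F e = 1) :
    ⇑F ∈ stateSpace e :=
  ⟨map_add F, monotone_of_map_nonneg F hF, hFe⟩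

theorem IsOrderUnit.coeff_nonneg [PosSMulReflectLE ℕ A] (he : IsOrderUnit e) {z : A}
    (hz : ¬0 ≤ z) {m : ℤ} {n : ℕ} (h : 0 ≤ m • e + n • z) : 0 ≤ m := by
  by_contra! hm
  have he_le : e ≤ n • z := by
    have : 0 ≤ (-m - 1) • e := zsmul_nonneg he.nonneg (by omega)
    rw [← sub_nonneg]
    convert add_nonneg h this using 1
    module
  obtain ⟨k, hk⟩ := he.exists_le_nsmul (-z)
  have hkz : 0 ≤ (k * n + 1) • z := by
    rw [succ_nsmul, mul_nsmul', ← neg_le_iff_add_nonneg]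
    exact hk.trans (nsmul_le_nsmul_right he_le k)
  exact hz (nonneg_of_smul_nonneg_of_pos_left hkz (Nat.succ_pos _))

theorem nonneg_of_forall_state_pos [PosSMulReflectLE ℕ A] (he : IsOrderUnit e) {z : A}
    (h : ∀ f ∈ stateSpace e, 0 < f z) : 0 ≤ z := by
  by_contra hz
  let c : ℤ × ℕ →+ A := (zmultiplesHom A e).coprod (multiplesHom A z)
  obtain ⟨f, hf⟩ := exists_orderAddMonoidHom_le c ((Int.castAddHom ℝ).comp (.fst ℤ ℕ))
    (fun _ hb => Int.cast_nonneg (he.coeff_nonneg hz hb))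
    fun x => let ⟨n, hn⟩ := he.exists_le_nsmul x; ⟨(n, 0), by simpa [c] using hn⟩
  have hf' (m : ℤ) (n : ℕ) : m * f e + n * f z ≤ m := by simpa [c] using hf (m, n)
  have hfe : f e = 1 := by
    have h₁ := hf' 1 0
    have h₂ := hf' (-1) 0
    push_cast at h₁ h₂
    linarith
  have hfz : f z ≤ 0 := by simpa using hf' 0 1
  have hf_mem := addMonoidHom_mem_stateSpace (f : A →+ ℝ) (fun _ => map_nonneg f) hfe
  exact (h f hf_mem).not_ge hfz

theorem zsmul_le_of_forall_extremePoints [PosSMulReflectLE ℕ A] (he : IsOrderUnit e) {y : A}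
    (h : ∀ f ∈ (stateSpace e).extremePoints ℝ, f y = 0) (n : ℤ) : n • y ≤ e := by
  rw [← sub_nonneg]
  refine nonneg_of_forall_state_pos he fun f hf => ?_
  have hfe := hf.2.2
  have hfy := apply_eq_zero_of_forall_extremePoints he h hf
  obtain ⟨F, rfl⟩ := exists_orderAddMonoidHom_of_mem_stateSpace hf
  rw [map_sub, map_zsmul, hfe, hfy]
  norm_num

/-- With `h = g - g e • f`, the state `f` is the midpoint of the states `f + h` and `f - h`. -/
theorem apply_eq_mul_of_le_extremePoint (he : 0 ≤ e) (hf : f ∈ (stateSpace e).extremePoints ℝ)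
    (g : A →+ ℝ) (hg : ∀ x, 0 ≤ x → 0 ≤ g x) (hgf : ∀ x, 0 ≤ x → g x ≤ f x) (x : A) :
    g x = g e * f x := by
  have hfe := hf.1.2.2
  obtain ⟨F, rfl⟩ := exists_orderAddMonoidHom_of_mem_stateSpace hf.1
  have hge : g e ≤ 1 := (hgf e he).trans_eq hfe
  let h : A →+ ℝ := g - g e • (F : A →+ ℝ)
  have hh (x : A) : h x = g x - g e * F x := rfl
  have mem_add : F + ⇑h ∈ stateSpace e := by
    refine addMonoidHom_mem_stateSpace ((F : A →+ ℝ) + h) (fun x hx => ?_) ?_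
    · change 0 ≤ F x + h x
      rw [hh]
      linarith [hg x hx, mul_nonneg (sub_nonneg.2 hge) (map_nonneg F hx)]
    · change F e + h e = 1
      rw [hh, hfe]
      ring
  have mem_sub : F - ⇑h ∈ stateSpace e := by
    refine addMonoidHom_mem_stateSpace ((F : A →+ ℝ) - h) (fun x hx => ?_) ?_
    · change 0 ≤ F x - h x
      rw [hh]
      linarith [hgf x hx, mul_nonneg (hg e he) (map_nonneg F hx)]
    · change F e - h e = 1
      rw [hh, hfe]
      ring
  have hmid : ⇑F ∈ openSegment ℝ (F + ⇑h) (F - ⇑h) :=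
    ⟨1 / 2, 1 / 2, by norm_num, by norm_num, by norm_num, by module⟩
  have hzero : h x = 0 := add_eq_left.1 (congrFun (hf.2 mem_add mem_sub hmid) x)
  rwa [hh, sub_eq_zero] at hzero

/-- On positive elements `g ∘ S ≤ g ∘ H = f`, so that extremality of `f` applies to `g ∘ S`. -/
theorem exists_extension_of_extremePoint {B : Type*} [AddCommGroup B] [Preorder B]
    [IsOrderedAddMonoid B] (he : 0 ≤ e) (hf : f ∈ (stateSpace e).extremePoints ℝ) (H : A →+ B)
    (hreflect : ∀ x, 0 ≤ H x → 0 ≤ x) (hcofinal : ∀ y, ∃ x, y ≤ H x) :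
    ∃ g : B →+o ℝ, (∀ x, g (H x) = f x) ∧
      ∀ S : A →+ B, (∀ x, 0 ≤ x → 0 ≤ S x ∧ S x ≤ H x) → ∀ x, g (S x) = g (S e) * f x := by
  obtain ⟨F, rfl⟩ := exists_orderAddMonoidHom_of_mem_stateSpace hf.1
  obtain ⟨g, hg⟩ := exists_orderAddMonoidHom_eq H (F : A →+ ℝ)
    (fun x hx => map_nonneg F (hreflect x hx)) hcofinal
  refine ⟨g, hg, fun S hS => ?_⟩
  exact apply_eq_mul_of_le_extremePoint he hf ((g : B →+ ℝ).comp S)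
    (fun x hx => map_nonneg g (hS x hx).1)
    fun x hx => (g.monotone' (hS x hx).2).trans_eq (hg x)

end States

section OrderIdeals

variable {G : Type*} [AddCommGroup G] [Preorder G]

instance posSMulReflectLE_addSubgroup [PosSMulReflectLE ℕ G] (I : AddSubgroup G) :
    PosSMulReflectLE ℕ I :=
  ⟨fun _ hn x y h => le_of_smul_le_smul_left (b₁ := (x : G)) (b₂ := y) h hn⟩

variable [IsOrderedAddMonoid G] {e u x : G}

/-- The order ideal generated by `e`: the elements squeezed between two multiples of `e`. -/
def orderIdeal (e : G) : AddSubgroup G where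
  carrier := {x | ∃ n : ℕ, x ≤ n • e ∧ -x ≤ n • e}
  zero_mem' := ⟨0, by simp⟩
  add_mem' := by
    rintro x y ⟨n, hx, hx'⟩ ⟨k, hy, hy'⟩
    refine ⟨n + k, ?_, ?_⟩
    · rw [add_nsmul]
      exact add_le_add hx hy
    · rw [add_nsmul, neg_add]
      exact add_le_add hx' hy'
  neg_mem' := by
    rintro x ⟨n, hx, hx'⟩
    exact ⟨n, hx', by rwa [neg_neg]⟩

theorem mem_orderIdeal_of_le (hx : 0 ≤ x) (hxe : x ≤ e) : x ∈ orderIdeal e :=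
  ⟨1, by rwa [one_nsmul], by rw [one_nsmul]; exact (neg_nonpos.2 hx).trans (hx.trans hxe)⟩

/-- The element `e`, viewed as an element of the order ideal it generates. -/
def orderIdealGenerator (he : 0 ≤ e) : orderIdeal e :=
  ⟨e, mem_orderIdeal_of_le he le_rfl⟩

theorem isOrderUnit_orderIdealGenerator (he : 0 ≤ e) : IsOrderUnit (orderIdealGenerator he) where
  nonneg := he
  exists_le_nsmul := fun ⟨_, n, hn, _⟩ => ⟨n, hn⟩

theorem map_mem_orderIdeal (T : G →+ G) (hT : ∀ x, 0 ≤ x → 0 ≤ T x) (hTe : T e ≤ u)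
    (hx : x ∈ orderIdeal e) : T x ∈ orderIdeal u := by
  have hmono {z : G} {n : ℕ} (hz : z ≤ n • e) : T z ≤ n • u := by
    refine (monotone_of_map_nonneg T hT hz).trans ?_
    rw [map_nsmul]
    exact nsmul_le_nsmul_right hTe n
  obtain ⟨n, hn, hn'⟩ := hx
  exact ⟨n, hmono hn, by rw [← map_neg]; exact hmono hn'⟩

/-- A positive map, viewed as a map between order ideals. -/
def orderIdealMap (T : G →+ G) (hT : ∀ x, 0 ≤ x → 0 ≤ T x) (hTe : T e ≤ u) :
    orderIdeal e →+ orderIdeal u :=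
  (T.comp (orderIdeal e).subtype).codRestrict _ fun x => map_mem_orderIdeal T hT hTe x.2

/-- `T` acts on the subgroup `I` as multiplication by a real number, as far as `f` can tell. Only
those `x ∈ I` are tested whose image under `T` is again in `I`. -/
def ActsAsScalar (I : AddSubgroup G) (f : I → ℝ) (T : G →+ G) : Prop :=
  ∃ c : ℝ, ∀ x y : I, T x = y → f y = c * f x

/-- The state `f` extends to a positive functional `g` on the order ideal of `H e` with
`g ∘ H = f`, and the two cases are whether `g` vanishes at `e`. -/
theorem eq_zero_or_actsAsScalar_of_extremePoint (he : 0 ≤ e) {f : orderIdeal e → ℝ}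
    (hf : f ∈ (stateSpace (orderIdealGenerator he)).extremePoints ℝ) (H : G →+ G)
    (hH : ∀ x, 0 ≤ x → x ≤ H x) (hreflect : ∀ x, 0 ≤ H x → 0 ≤ x) :
    (∀ x y : orderIdeal e, H x = y → f x = 0) ∨
      ∀ S : G →+ G, (∀ x, 0 ≤ x → 0 ≤ S x ∧ S x ≤ H x) → ActsAsScalar (orderIdeal e) f S := by
  let e' := orderIdealGenerator he
  let ι : orderIdeal e →+ orderIdeal (H e) := orderIdealMap (.id G) (fun _ => id) (hH e he)
  let H' : orderIdeal e →+ orderIdeal (H e) :=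
    orderIdealMap H (fun x hx => hx.trans (hH x hx)) le_rfl
  obtain ⟨g, hgH, hg⟩ := exists_extension_of_extremePoint (e := e') he hf H'
    (fun x => hreflect x) fun ⟨y, n, hn, _⟩ => ⟨n • e', hn.trans_eq (map_nsmul H n e).symm⟩
  have hgι : ∀ x, g (ι x) = g (ι e') * f x := hg ι fun x hx => ⟨hx, hH x hx⟩
  rcases eq_or_ne (g (ι e')) 0 with h | h
  · left
    intro x y hxy
    have hxy' : H' x = ι y := Subtype.ext hxy
    rw [← hgH, hxy', hgι, h, zero_mul]
  · right
    intro S hS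
    let S' : orderIdeal e →+ orderIdeal (H e) :=
      orderIdealMap S (fun x hx => (hS x hx).1) (hS e he).2
    refine ⟨g (S' e') / g (ι e'), fun x y hxy => ?_⟩
    have hxy' : S' x = ι y := Subtype.ext hxy
    have hgS : g (S' x) = g (S' e') * f x := hg S' (fun x hx => hS x hx) x
    rw [hxy', hgι] at hgS
    rw [div_mul_eq_mul_div, eq_div_iff h, mul_comm, hgS]

end OrderIdeals

section Localizable

variable {G : Type*} [AddCommGroup G] [Preorder G] {m : G →+ G →+ G} {s e : G}

/-- Localizability of a positive element of a preordered group with respect to a biadditive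
operation: `x ↦ x + s x` and `x ↦ x + x s` reflect positivity. -/
structure IsPosLocalizable (m : G →+ G →+ G) (s : G) : Prop where
  nonneg : 0 ≤ s
  nonneg_of_left : ∀ x, 0 ≤ x + m s x → 0 ≤ x
  nonneg_of_right : ∀ x, 0 ≤ x + m x s → 0 ≤ x

theorem IsPosLocalizable.flip (hs : IsPosLocalizable m s) : IsPosLocalizable m.flip s :=
  ⟨hs.nonneg, hs.nonneg_of_right, hs.nonneg_of_left⟩

variable [IsOrderedAddMonoid G]

theorem IsPosLocalizable.eq_zero_or_actsAsScalar_left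
    (hm : ∀ x y, 0 ≤ x → 0 ≤ y → 0 ≤ m x y) (hs : IsPosLocalizable m s) (he : 0 ≤ e)
    {f : orderIdeal e → ℝ} (hf : f ∈ (stateSpace (orderIdealGenerator he)).extremePoints ℝ) :
    (∀ x : orderIdeal e, m s x ∈ orderIdeal e → f x = 0) ∨
      ∀ a ∈ Set.Icc 0 s, ActsAsScalar (orderIdeal e) f (m a) := by
  have hle (x : G) (hx : 0 ≤ x) : x ≤ x + m s x := le_add_of_nonneg_right (hm s x hs.nonneg hx)
  refine (eq_zero_or_actsAsScalar_of_extremePoint he hf (.id G + m s) hle hs.nonneg_of_left).imp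
    (fun h x hx => h x ⟨x + m s x, add_mem x.2 hx⟩ rfl)
    fun h a ha => h (m a) fun x hx => ⟨hm a x ha.1 hx, ?_⟩
  have hax : m a x ≤ m s x := by
    rw [← sub_nonneg, ← AddMonoidHom.sub_apply, ← map_sub]
    exact hm _ x (sub_nonneg.2 ha.2) hx
  exact hax.trans (le_add_of_nonneg_left hx)

theorem IsPosLocalizable.eq_zero_or_actsAsScalar
    (hm : ∀ x y, 0 ≤ x → 0 ≤ y → 0 ≤ m x y) (hs : IsPosLocalizable m s) (he : 0 ≤ e)
    {f : orderIdeal e → ℝ} (hf : f ∈ (stateSpace (orderIdealGenerator he)).extremePoints ℝ) :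
    (∀ x : orderIdeal e, m s x ∈ orderIdeal e → m x s ∈ orderIdeal e → f x = 0) ∨
      ∀ a ∈ Set.Icc 0 s, ActsAsScalar (orderIdeal e) f (m a) ∧
        ActsAsScalar (orderIdeal e) f (m.flip a) := by
  rcases hs.eq_zero_or_actsAsScalar_left hm he hf with h | hleft
  · exact .inl fun x hx _ => h x hx
  rcases hs.flip.eq_zero_or_actsAsScalar_left (fun x y hx hy => hm y x hy hx) he hf with h | hright
  · exact .inl fun x _ hx => h x hx
  exact .inr fun a ha => ⟨hleft a ha, hright a ha⟩

variable [PosSMulReflectLE ℕ G]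

/-- The elements of `l` are those, apart from `y` and `z`, at which `f` may be evaluated. -/
theorem IsPosLocalizable.bddAbove_zmultiples_sub_of_forall_actsAsScalar
    (hm : ∀ x y, 0 ≤ x → 0 ≤ y → 0 ≤ m x y) (hs : IsPosLocalizable m s) {y z : G}
    (hy : 0 ≤ y) (hz : 0 ≤ z) (l : List G)
    (hl : ∀ x ∈ l, 0 ≤ x)
    (h : ∀ (I : AddSubgroup G) (f : I → ℝ), (∀ x ∈ l, x ∈ I) →
      (∀ a ∈ Set.Icc 0 s, ActsAsScalar I f (m a) ∧ ActsAsScalar I f (m.flip a)) →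
      ∀ u v : I, ↑u = y → ↑v = z → f u = f v) :
    BddAbove (AddSubgroup.zmultiples (y - z) : Set G) := by
  let l' := y :: z :: m s y :: m y s :: m s z :: m z s :: l
  have hl' : ∀ x ∈ l', 0 ≤ x := by
    simp only [l', List.forall_mem_cons]
    exact ⟨hy, hz, hm _ _ hs.nonneg hy, hm _ _ hy hs.nonneg, hm _ _ hs.nonneg hz,
      hm _ _ hz hs.nonneg, hl⟩
  let e := l'.sum
  have he : 0 ≤ e := List.sum_nonneg hl'
  have hmem : ∀ x ∈ l', x ∈ orderIdeal e := fun x hx =>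
    mem_orderIdeal_of_le (hl' x hx) (List.single_le_sum hl' x hx)
  simp only [l', List.forall_mem_cons] at hmem
  obtain ⟨hy, hz, hsy, hys, hsz, hzs, hl⟩ := hmem
  have hzero : ∀ f ∈ (stateSpace (orderIdealGenerator he)).extremePoints ℝ,
      f (⟨y, hy⟩ - ⟨z, hz⟩) = 0 := fun f hf => by
    have hsub : f (⟨y, hy⟩ - ⟨z, hz⟩) = f ⟨y, hy⟩ - f ⟨z, hz⟩ := by
      obtain ⟨F, rfl⟩ := exists_orderAddMonoidHom_of_mem_stateSpace hf.1
      exact map_sub F _ _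
    rw [hsub, sub_eq_zero]
    rcases hs.eq_zero_or_actsAsScalar hm he hf with hf₀ | hscalar
    · rw [hf₀ _ hsy hys, hf₀ _ hsz hzs]
    · exact h _ f hl hscalar _ _ rfl rfl
  refine ⟨e, ?_⟩
  rintro _ ⟨n, rfl⟩
  exact zsmul_le_of_forall_extremePoints (isOrderUnit_orderIdealGenerator he) hzero n

theorem IsPosLocalizable.bddAbove_commutator (hm : ∀ x y, 0 ≤ x → 0 ≤ y → 0 ≤ m x y)
    (hs : IsPosLocalizable m s) {a b : G} (ha : a ∈ Set.Icc 0 s) (hb : b ∈ Set.Icc 0 s) :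
    BddAbove (AddSubgroup.zmultiples (m a b - m b a) : Set G) := by
  refine hs.bddAbove_zmultiples_sub_of_forall_actsAsScalar hm (hm a b ha.1 hb.1)
    (hm b a hb.1 ha.1) [a, b, m a a]
    (by simpa using ⟨ha.1, hb.1, hm a a ha.1 ha.1⟩) fun I f hI hf ab ba hab hba => ?_
  obtain ⟨ha', hb', haa'⟩ : a ∈ I ∧ b ∈ I ∧ m a a ∈ I := by simpa using hI
  lift a to I using ha'
  lift b to I using hb'
  obtain ⟨⟨la, hla⟩, ra, hra⟩ := hf a ha
  obtain ⟨⟨lb, hlb⟩, rb, hrb⟩ := hf b hb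
  have haa : la * f a = ra * f a := (hla a ⟨_, haa'⟩ rfl).symm.trans (hra a ⟨_, haa'⟩ rfl)
  rcases eq_or_ne (f a) 0 with h₀ | h₀
  · rw [hrb a ab hab.symm, hlb a ba hba.symm, h₀, mul_zero, mul_zero]
  · rw [hla b ab hab.symm, hra b ba hba.symm, mul_right_cancel₀ h₀ haa]

theorem IsPosLocalizable.bddAbove_associator (hm : ∀ x y, 0 ≤ x → 0 ≤ y → 0 ≤ m x y)
    (hs : IsPosLocalizable m s) {a b c : G} (ha : a ∈ Set.Icc 0 s) (hb : 0 ≤ b)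
    (hc : c ∈ Set.Icc 0 s) :
    BddAbove (AddSubgroup.zmultiples (m (m a b) c - m a (m b c)) : Set G) := by
  have hab := hm a b ha.1 hb
  have hbc := hm b c hb hc.1
  refine hs.bddAbove_zmultiples_sub_of_forall_actsAsScalar hm (hm _ c hab hc.1)
    (hm a _ ha.1 hbc) [b, m a b, m b c]
    (by simpa using ⟨hb, hab, hbc⟩) fun I f hI hf ab_c a_bc hab_c ha_bc => ?_
  obtain ⟨hb', hab', hbc'⟩ : b ∈ I ∧ m a b ∈ I ∧ m b c ∈ I := by simpa using hI
  obtain ⟨⟨la, hla⟩, -⟩ := hf a ha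
  obtain ⟨-, rc, hrc⟩ := hf c hc
  calc
    f ab_c = rc * (la * f ⟨b, hb'⟩) := by
      rw [hrc ⟨_, hab'⟩ ab_c hab_c.symm, hla ⟨b, hb'⟩ ⟨_, hab'⟩ rfl]
    _ = la * (rc * f ⟨b, hb'⟩) := mul_left_comm _ _ _
    _ = f a_bc := by rw [hla ⟨_, hbc'⟩ a_bc ha_bc.symm, hrc ⟨b, hb'⟩ ⟨_, hbc'⟩ rfl]

end Localizable

section RedGrothSnd

open Algebra.GrothendieckAddGroup

variable {M : Type*} [AddCommMonoid M] {μ : M → M → M}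

/-- The preorder on the Grothendieck group with positive cone `ι(M)^up`. It extends the canonical
quasi-order of `M`, see `groth_of_le_of_iff`. -/
local instance grothPreorder : Preorder (Algebra.GrothendieckAddGroup M) where
  le x y := y - x ∈ (grothImage M).up
  le_refl x := by rw [sub_self]; exact zero_mem _
  le_trans x y z hxy hyz := by rw [← sub_add_sub_cancel z y x]; exact add_mem hyz hxy

theorem groth_nonneg_iff {x : Algebra.GrothendieckAddGroup M} :
    0 ≤ x ↔ x ∈ (grothImage M).up := by
  change x - 0 ∈ _ ↔ _
  rw [sub_zero]

local instance : IsOrderedAddMonoid (Algebra.GrothendieckAddGroup M) where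
  add_le_add_left x y h z := by
    change y + z - (x + z) ∈ _
    rwa [add_sub_add_right_eq_sub]

local instance : PosSMulReflectLE ℕ (Algebra.GrothendieckAddGroup M) where
  le_of_smul_le_smul_left k hk x y := by
    rintro ⟨l, hl, h⟩
    refine ⟨l * k, Nat.mul_pos hl hk, ?_⟩
    rwa [mul_nsmul', nsmul_sub]

theorem groth_of_nonneg (a : M) : 0 ≤ of a :=
  groth_nonneg_iff.2 ⟨1, one_pos, a, (one_nsmul _).symm⟩

theorem groth_of_le_of_iff {a b : M} : of a ≤ of b ↔ CanLE a b := by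
  constructor
  · rintro ⟨k, hk, c, h⟩
    have h' : of (k • a + c) = of (k • b) := by
      rw [map_add, h, nsmul_sub, map_nsmul, map_nsmul, add_sub_cancel]
    obtain ⟨t, ht⟩ := (AddLocalization.addMonoidOf (⊤ : AddSubmonoid M)).eq_iff_exists.1 h'
    exact ⟨c, t, k, hk, by rw [add_comm, ht, add_comm]⟩
  · rintro ⟨c, t, k, hk, h⟩
    refine ⟨k, hk, c, ?_⟩
    have h' := congrArg (of (M := M)) h
    simp only [map_add, map_nsmul] at h'
    rw [nsmul_sub, eq_sub_iff_add_eq, add_comm]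
    exact add_right_cancel h'

theorem grothMul_nonneg (hμ : IsBiadditive μ) (x y : Algebra.GrothendieckAddGroup M)
    (hx : 0 ≤ x) (hy : 0 ≤ y) : 0 ≤ grothMul μ hμ x y := by
  obtain ⟨k, hk, a, ha⟩ := groth_nonneg_iff.1 hx
  obtain ⟨l, hl, b, hb⟩ := groth_nonneg_iff.1 hy
  refine groth_nonneg_iff.2 ⟨l * k, Nat.mul_pos hl hk, μ a b, ?_⟩
  rw [← grothMul_of μ hμ, ha, hb, map_nsmul, map_nsmul, AddMonoidHom.nsmul_apply, mul_nsmul']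

theorem IsLocalizable.isPosLocalizable_grothMul (hμ : IsBiadditive μ) {s : M}
    (hs : IsLocalizable μ s) : IsPosLocalizable (grothMul μ hμ) (of s) := by
  refine ⟨groth_of_nonneg s, fun x hx => ?_, fun x hx => ?_⟩ <;>
    obtain ⟨a, b, rfl⟩ := groth_exists_sub x
  · rw [sub_nonneg, groth_of_le_of_iff]
    refine hs.1 b a (groth_of_le_of_iff.1 ?_)
    rw [← sub_nonneg]
    convert hx using 1
    simp only [map_add, map_sub, grothMul_of]
    abel
  · rw [sub_nonneg, groth_of_le_of_iff]
    refine hs.2 b a (groth_of_le_of_iff.1 ?_)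
    rw [← sub_nonneg]
    convert hx using 1
    simp only [map_add, map_sub, AddMonoidHom.sub_apply, grothMul_of]
    abel

theorem IsWeaklyLocalizable.exists_isPosLocalizable (hμ : IsBiadditive μ)
    (hloc : IsWeaklyLocalizable μ) (a b : M) :
    ∃ s, IsPosLocalizable (grothMul μ hμ) s ∧ of a ∈ Set.Icc 0 s ∧ of b ∈ Set.Icc 0 s := by
  obtain ⟨s, hs, h⟩ := hloc (a + b)
  rw [← groth_of_le_of_iff, map_add] at h
  exact ⟨of s, hs.isPosLocalizable_grothMul hμ,
    ⟨groth_of_nonneg a, (le_add_of_nonneg_right (groth_of_nonneg b)).trans h⟩,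
    ⟨groth_of_nonneg b, (le_add_of_nonneg_left (groth_of_nonneg a)).trans h⟩⟩

theorem redSndOf_eq_of_bddAbove {a b : M}
    (h : BddAbove (AddSubgroup.zmultiples (of a - of b) : Set (Algebra.GrothendieckAddGroup M))) :
    redSndOf M a = redSndOf M b := by
  obtain ⟨e, he⟩ := h
  have hmem (n : ℤ) : n • (of a - of b) + e ∈ (grothImage M).up := by
    have : -n • (of a - of b) ≤ e := he ⟨-n, rfl⟩
    rwa [← groth_nonneg_iff, ← neg_le_iff_add_nonneg', ← neg_zsmul]
  have hker : of a - of b ∈ redSndKer M :=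
    ⟨⟨e, fun l _ => by simpa only [natCast_zsmul] using hmem l⟩,
      ⟨e, fun l _ => by simpa only [neg_zsmul, natCast_zsmul, smul_neg] using hmem (-l)⟩⟩
  exact QuotientAddGroup.eq_iff_sub_mem.2 hker

theorem redSndOf_comm (hμ : IsBiadditive μ) (hloc : IsWeaklyLocalizable μ) (a b : M) :
    redSndOf M (μ a b) = redSndOf M (μ b a) := by
  obtain ⟨s, hs, ha, hb⟩ := hloc.exists_isPosLocalizable hμ a b
  apply redSndOf_eq_of_bddAbove
  simpa only [grothMul_of] using hs.bddAbove_commutator (grothMul_nonneg hμ) ha hb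

theorem redSndOf_assoc (hμ : IsBiadditive μ) (hloc : IsWeaklyLocalizable μ) (a b c : M) :
    redSndOf M (μ (μ a b) c) = redSndOf M (μ a (μ b c)) := by
  obtain ⟨s, hs, ha, hc⟩ := hloc.exists_isPosLocalizable hμ a c
  apply redSndOf_eq_of_bddAbove
  simpa only [grothMul_of] using
    hs.bddAbove_associator (grothMul_nonneg hμ) ha (groth_of_nonneg b) hc

theorem redSnd_exists_sub (x : RedGrothSnd M) :
    ∃ a b : M, x = redSndOf M a - redSndOf M b := by
  induction x using QuotientAddGroup.induction_on with | H x => ?_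
  obtain ⟨a, b, rfl⟩ := groth_exists_sub x
  exact ⟨a, b, rfl⟩

variable (μ) in
/-- The operation `redSndMul μ hμ`, bundled as a biadditive map. -/
noncomputable def redSndMulHom (hμ : IsBiadditive μ) :
    RedGrothSnd M →+ RedGrothSnd M →+ RedGrothSnd M :=
  have hadd := ((redSndMul_unique μ hμ _).2 rfl).1
  .mk' (fun x => .mk' (redSndMul μ hμ x) (hadd.add_right x))
    fun x y => AddMonoidHom.ext (hadd.add_left x y)

theorem redSndMulHom_of (hμ : IsBiadditive μ) (a b : M) :
    redSndMulHom μ hμ (redSndOf M a) (redSndOf M b) = redSndOf M (μ a b) :=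
  ((redSndMul_unique μ hμ _).2 rfl).2 a b

theorem redSndMulHom_comm (hμ : IsBiadditive μ) (hloc : IsWeaklyLocalizable μ)
    (x y : RedGrothSnd M) : redSndMulHom μ hμ x y = redSndMulHom μ hμ y x := by
  obtain ⟨a, a', rfl⟩ := redSnd_exists_sub x
  obtain ⟨b, b', rfl⟩ := redSnd_exists_sub y
  simp only [map_sub, AddMonoidHom.sub_apply, redSndMulHom_of, redSndOf_comm hμ hloc b,
    redSndOf_comm hμ hloc b']
  abel

theorem redSndMulHom_assoc (hμ : IsBiadditive μ) (hloc : IsWeaklyLocalizable μ)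
    (x y z : RedGrothSnd M) :
    redSndMulHom μ hμ (redSndMulHom μ hμ x y) z = redSndMulHom μ hμ x (redSndMulHom μ hμ y z) := by
  obtain ⟨a, a', rfl⟩ := redSnd_exists_sub x
  obtain ⟨b, b', rfl⟩ := redSnd_exists_sub y
  obtain ⟨c, c', rfl⟩ := redSnd_exists_sub z
  simp only [map_sub, AddMonoidHom.sub_apply, redSndMulHom_of, redSndOf_assoc hμ hloc]

end RedGrothSnd

theorem mainTheorem5 {M : Type*} [AddCommMonoid M] (μ : M → M → M) (hμ : IsBiadditive μ)
    (hloc : IsWeaklyLocalizable μ) :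
    (∀ x y z : RedGrothSnd M,
      redSndMul μ hμ (redSndMul μ hμ x y) z = redSndMul μ hμ x (redSndMul μ hμ y z)) ∧
    (∀ x y : RedGrothSnd M, redSndMul μ hμ x y = redSndMul μ hμ y x) ∧
    ∃ R : NonUnitalCommRing (RedGrothSnd M),
      R.toAddCommGroup = QuotientAddGroup.Quotient.addCommGroup (redSndKer M) ∧
      ∀ x y : RedGrothSnd M, R.mul x y = redSndMul μ hμ x y := by
  have hassoc := redSndMulHom_assoc hμ hloc
  have hcomm := redSndMulHom_comm hμ hloc
  exact ⟨hassoc, hcomm,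
    { QuotientAddGroup.Quotient.addCommGroup (redSndKer M) with
      mul := redSndMul μ hμ
      left_distrib := fun x => map_add (redSndMulHom μ hμ x)
      right_distrib := fun x y => DFunLike.congr_fun (map_add (redSndMulHom μ hμ) x y)
      zero_mul := DFunLike.congr_fun (map_zero (redSndMulHom μ hμ))
      mul_zero := fun x => map_zero (redSndMulHom μ hμ x)
      mul_assoc := hassoc
      mul_comm := hcomm }, rfl, fun _ _ => rfl⟩
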